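/- Let $t_0\in\mathbb R$ and consider the system $\dot x=f(t,x)$, $t\ge t_0$, with state $x\in\mathbb R^n$. Assume that $f(t,x)$ is piecewise continuous in $t$ and continuously differentiable in $x$, that its Jacobian $\partial f/\partial x$ is bounded on $[t_0,T]\times C$ for every $T\ge t_0$ and every compact $C\subset\mathbb R^n$, and that every initial state $x$ at time $t_0$ has a solution $\xi(\cdot,t_0,x)$ on all of $[t_0,\infty)$ (forward completeness; this solution is then unique). Let $K\subset\mathbb R^n$ be a compact set with nonempty interior, put $\xi(t,t_0,K)=\{\xi(t,t_0,x):x\in K\}$, and let $|\cdot|$ be any norm on $\mathbb R^n$. For $T\ge0$ and $\varepsilon>0$ let $S(f,t_0,\varepsilon,T,K)$ be the minimal cardinality of a set $E\subset K$ such that for every $\bar x\in K$ there is $x\in E$ with $|\xi(t,t_0,\bar x)-\xi(t,t_0,x)|<\varepsilon$ for all $t\in[t_0,t_0+T]$. The topological entropy of the system with initial set $K$ at initial time $t_0$ is $$h(f,t_0,K)=\lim_{\varepsilon\searrow0}\limsup_{T\to\infty}\frac1T\log S(f,t_0,\varepsilon,T,K).$$ Suppose that $\hat A=[\hat a_{ij}]\in\mathbb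 R^{n\times n}$ is a Metzler matrix (all off-diagonal entries are nonnegative) such that, for all $i\ne j$ in $\{1,\dots,n\}$, $$\hat a_{ij}\ \ge\ \limsup_{t\to\infty}\ \max_{v\in\operatorname{co}(\xi(t,t_0,K))}\left|\frac{\partial f_i}{\partial x_j}(t,v)\right|,$$ and, for all $i\in\{1,\dots,n\}$, $$\hat a_{ii}\ \ge\ \limsup_{t\to\infty}\ \max_{v\in\operatorname{co}(\xi(t,t_0,K))}\frac{\partial f_i}{\partial x_i}(t,v),$$ where $\operatorname{co}$ denotes the convex hull. Then $$h(f,t_0,K)\ \le\ n\max\{\alpha(\hat A),0\},$$ where $\alpha(\hat A)$ is the largest real part of an eigenvalue of $\hat A$. -/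

import Mathlib

open Set Filter Topology MeasureTheory

namespace TVSys

/-- `g` is piecewise continuous on `[t₀, ∞)`: finitely many discontinuities in each bounded
interval `[t₀, T]`, and finite one-sided limits everywhere. -/
def PiecewiseContinuousFrom {F : Type*} [TopologicalSpace F] (t₀ : ℝ) (g : ℝ → F) : Prop :=
  (∀ T : ℝ, {t ∈ Icc t₀ T | ¬ ContinuousWithinAt g (Ici t₀) t}.Finite) ∧
  (∀ t, t₀ ≤ t → ∃ l, Tendsto g (𝓝[>] t) (𝓝 l)) ∧
  (∀ t, t₀ < t → ∃ l, Tendsto g (𝓝[<] t) (𝓝 l))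

/-- The standing regularity of the right-hand side of `ẋ = f (t, x)`, `t ≥ t₀`: piecewise
continuous in `t`, continuously differentiable in `x`, with a Jacobian that is bounded on bounded
time intervals and compact sets of states. The last clause holds whenever the Jacobian is
piecewise continuous in `t` jointly with `x`. -/
structure Regular {n : ℕ} (f : ℝ → (Fin n → ℝ) → (Fin n → ℝ)) (t₀ : ℝ) : Prop where
  piecewiseContinuous : ∀ x, PiecewiseContinuousFrom t₀ (fun t => f t x)
  contDiff : ∀ t, t₀ ≤ t → ContDiff ℝ 1 (f t)
  jacobian_locally_bounded : ∀ (T : ℝ) (C : Set (Fin n → ℝ)), IsCompact C →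
    ∃ L : ℝ, ∀ t ∈ Icc t₀ T, ∀ x ∈ C, ‖fderiv ℝ (f t) x‖ ≤ L

/-- `φ` is a solution on `[t₀, ∞)` of `ẋ = f (t, x)` with `φ t₀ = x₀`, in integrated form;
equivalently `φ` is locally absolutely continuous on `[t₀, ∞)` and satisfies the equation at
almost every time. -/
def IsSolution {n : ℕ} (f : ℝ → (Fin n → ℝ) → (Fin n → ℝ)) (t₀ : ℝ) (x₀ : Fin n → ℝ)
    (φ : ℝ → (Fin n → ℝ)) : Prop :=
  ContinuousOn φ (Ici t₀) ∧
  ∀ t, t₀ ≤ t → IntervalIntegrable (fun s => f s (φ s)) volume t₀ t ∧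
    φ t = x₀ + ∫ s in t₀..t, f s (φ s)

/-- Forward completeness: every initial state at time `t₀` has a solution on all of `[t₀, ∞)`. -/
def ForwardComplete {n : ℕ} (f : ℝ → (Fin n → ℝ) → (Fin n → ℝ)) (t₀ : ℝ) : Prop :=
  ∀ x₀, ∃ φ, IsSolution f t₀ x₀ φ

open Classical in
/-- `flow f t₀ t x` is the value `ξ(t, t₀, x)` at time `t ≥ t₀` of the solution with state `x` at
time `t₀`. -/
noncomputable def flow {n : ℕ} (f : ℝ → (Fin n → ℝ) → (Fin n → ℝ)) (t₀ t : ℝ)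
    (x : Fin n → ℝ) : Fin n → ℝ :=
  if h : ∃ φ, IsSolution f t₀ x φ then h.choose t else 0

/-- The reachable set `ξ(t, t₀, K)`. -/
noncomputable def reach {n : ℕ} (f : ℝ → (Fin n → ℝ) → (Fin n → ℝ)) (t₀ t : ℝ)
    (K : Set (Fin n → ℝ)) : Set (Fin n → ℝ) :=
  flow f t₀ t '' K

/-- The open ball of radius `ε` over the time horizon `T`, with respect to the norm `N`. -/
def dynBall {n : ℕ} (N : Seminorm ℝ (Fin n → ℝ)) (f : ℝ → (Fin n → ℝ) → (Fin n → ℝ)) (t₀ : ℝ)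
    (x : Fin n → ℝ) (ε T : ℝ) : Set (Fin n → ℝ) :=
  {y | ∀ t ∈ Icc t₀ (t₀ + T), N (flow f t₀ t y - flow f t₀ t x) < ε}

/-- `E` is a `(T, ε)`-spanning subset of `K`. -/
def IsSpanning {n : ℕ} (N : Seminorm ℝ (Fin n → ℝ)) (f : ℝ → (Fin n → ℝ) → (Fin n → ℝ)) (t₀ : ℝ)
    (ε T : ℝ) (K E : Set (Fin n → ℝ)) : Prop :=
  E ⊆ K ∧ K ⊆ ⋃ x ∈ E, dynBall N f t₀ x ε T

/-- `S(f, t₀, ε, T, K)`: the minimal cardinality of a `(T, ε)`-spanning set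
(`⊤` if there is no finite one). -/
noncomputable def minSpan {n : ℕ} (N : Seminorm ℝ (Fin n → ℝ))
    (f : ℝ → (Fin n → ℝ) → (Fin n → ℝ)) (t₀ ε T : ℝ) (K : Set (Fin n → ℝ)) : ℕ∞ :=
  ⨅ (E : Set (Fin n → ℝ)) (_ : IsSpanning N f t₀ ε T K E), E.encard

/-- The exponential growth rate `limsup_{T → ∞} (1/T) log S(f, t₀, ε, T, K)`. -/
noncomputable def entropyAt {n : ℕ} (N : Seminorm ℝ (Fin n → ℝ))
    (f : ℝ → (Fin n → ℝ) → (Fin n → ℝ)) (t₀ : ℝ) (K : Set (Fin n → ℝ)) (ε : ℝ) : EReal :=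
  limsup (fun T : ℝ => ENNReal.log (minSpan N f t₀ ε T K : ENNReal) / (T : EReal)) atTop

/-- The topological entropy `h(f, t₀, K)`: the limit of the growth rates as `ε ↘ 0`, which is
their supremum because they are nonincreasing in `ε`; see `tendsto_entropyAt`. -/
noncomputable def entropy {n : ℕ} (N : Seminorm ℝ (Fin n → ℝ))
    (f : ℝ → (Fin n → ℝ) → (Fin n → ℝ)) (t₀ : ℝ) (K : Set (Fin n → ℝ)) : EReal :=
  ⨆ (ε : ℝ) (_ : 0 < ε), entropyAt N f t₀ K ε

theorem entropyAt_antitone {n : ℕ} (N : Seminorm ℝ (Fin n → ℝ))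
    (f : ℝ → (Fin n → ℝ) → (Fin n → ℝ)) (t₀ : ℝ) (K : Set (Fin n → ℝ)) :
    Antitone (entropyAt N f t₀ K) := by
  intro ε δ h
  refine limsup_le_limsup ?_
  filter_upwards [eventually_gt_atTop (0 : ℝ)] with T hT
  refine EReal.div_le_div_right_of_nonneg (by exact_mod_cast hT.le) ?_
  refine ENNReal.log_monotone ?_
  refine ENat.toENNReal_le.2 ?_
  refine le_iInf₂ fun E hE => iInf₂_le E ⟨hE.1, hE.2.trans ?_⟩
  exact iUnion₂_mono fun x _ y hy t ht => (hy t ht).trans_le h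

theorem tendsto_entropyAt {n : ℕ} (N : Seminorm ℝ (Fin n → ℝ))
    (f : ℝ → (Fin n → ℝ) → (Fin n → ℝ)) (t₀ : ℝ) (K : Set (Fin n → ℝ)) :
    Tendsto (entropyAt N f t₀ K) (𝓝[>] 0) (𝓝 (entropy N f t₀ K)) := by
  have h := (entropyAt_antitone N f t₀ K).tendsto_nhdsGT (0 : ℝ)
  rwa [sSup_image] at h

/-- `∂f_i/∂x_j (t, v)`. -/
noncomputable def partialDeriv {n : ℕ} (f : ℝ → (Fin n → ℝ) → (Fin n → ℝ)) (i j : Fin n) (t : ℝ)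
    (v : Fin n → ℝ) : ℝ :=
  fderiv ℝ (f t) v (Pi.single j 1) i

/-- Metzler matrices: nonnegative off-diagonal entries. -/
def IsMetzler {n : ℕ} (M : Matrix (Fin n) (Fin n) ℝ) : Prop :=
  ∀ i j, i ≠ j → 0 ≤ M i j

/-- The largest real part of a complex eigenvalue of `M`. -/
noncomputable def spectralAbscissa {n : ℕ} (M : Matrix (Fin n) (Fin n) ℝ) : ℝ :=
  sSup {r : ℝ | ∃ z : ℂ,
    Module.End.HasEigenvalue (Matrix.toLin' (M.map (algebraMap ℝ ℂ))) z ∧ z.re = r}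

end TVSys

/-!
Fix `μ > max (α(Â)) 0`. Perron–Frobenius theory for Metzler matrices gives a vector `p > 0` with
`Â p < μ p`, and this survives a small increase of all entries to a matrix `B` whose entries
eventually dominate those of the Jacobian on the convex hull of the reachable set. By the mean
value theorem the difference `z` of two solutions then satisfies `z_i z_i' ≤ |z_i| (B |z|)_i`, and
`|z|` can never touch the supersolution `c p exp (μ t)` of the cooperative system `ẇ = B w`. Hence
the flow expands distances in `K` by at most `M exp (μ t)`, so a cover of `K` by `O(exp (n μ T))`
balls of radius of order `ε exp (-μ T)` is `(T, ε)`-spanning. Let `μ ↘ max (α(Â)) 0`.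
-/

namespace TVSys

open scoped Matrix NNReal

section Metzler

variable {n : ℕ} {A : Matrix (Fin n) (Fin n) ℝ}

theorem re_le_spectralAbscissa {z : ℂ}
    (hz : Module.End.HasEigenvalue (Matrix.toLin' (A.map (algebraMap ℝ ℂ))) z) :
    z.re ≤ spectralAbscissa A :=
  le_csSup ((Module.End.finite_hasEigenvalue _).image Complex.re).bddAbove ⟨z, hz, rfl⟩

theorem isUnit_det_scalar_sub {s : ℝ} (hs : spectralAbscissa A < s) :
    IsUnit (Matrix.scalar (Fin n) s - A).det := by
  refine isUnit_iff_ne_zero.2 fun hdet => hs.not_ge ?_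
  have hroot : A.charpoly.IsRoot s := by rw [Polynomial.IsRoot, Matrix.eval_charpoly, hdet]
  refine re_le_spectralAbscissa (z := algebraMap ℝ ℂ s) ?_
  rw [Module.End.hasEigenvalue_iff_isRoot_charpoly, Matrix.charpoly_toLin', Matrix.charpoly_map]
  exact hroot.map

theorem IsMetzler.mulVec_le_mulVec (hA : IsMetzler A) {p q : Fin n → ℝ} (hpq : p ≤ q) {i : Fin n}
    (hi : p i = q i) : (A *ᵥ p) i ≤ (A *ᵥ q) i := by
  rw [Matrix.mulVec, Matrix.mulVec, dotProduct, dotProduct]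
  refine Finset.sum_le_sum fun j _ => ?_
  by_cases hij : i = j
  · rw [← hij, hi]
  · exact mul_le_mul_of_nonneg_left (hpq j) (hA i j hij)

theorem IsMetzler.pos_of_nonneg_of_mulVec_lt (hA : IsMetzler A) {p : Fin n → ℝ} {s : ℝ}
    (hp : 0 ≤ p) (h : ∀ i, (A *ᵥ p) i < s * p i) (i : Fin n) : 0 < p i := by
  refine (hp i).lt_of_ne fun hi => (h i).not_ge ?_
  simpa [← hi] using hA.mulVec_le_mulVec hp hi

theorem IsMetzler.nonneg_of_mulVec_le (hA : IsMetzler A) {p : Fin n → ℝ} {s : ℝ}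
    (hs : ∀ i, ∑ j, A i j < s) (h : ∀ i, (A *ᵥ p) i ≤ s * p i) : 0 ≤ p := by
  intro i
  obtain ⟨k, -, hk⟩ := Finset.exists_min_image Finset.univ p ⟨i, Finset.mem_univ i⟩
  have hconst : (∑ j, A k j) * p k ≤ (A *ᵥ p) k := by
    simpa [Matrix.mulVec, dotProduct, Finset.sum_mul] using
      hA.mulVec_le_mulVec (p := fun _ => p k) (fun j => hk j (Finset.mem_univ j)) rfl
  have hpk : 0 ≤ (s - ∑ j, A k j) * p k := by linarith [h k]
  exact (nonneg_of_mul_nonneg_right hpk (sub_pos.2 (hs k))).trans (hk i (Finset.mem_univ i))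

theorem mulVec_resolvent_apply {s : ℝ} (hs : spectralAbscissa A < s) (q : Fin n → ℝ) (i : Fin n) :
    (A *ᵥ ((Matrix.scalar (Fin n) s - A)⁻¹ *ᵥ q)) i =
      s * ((Matrix.scalar (Fin n) s - A)⁻¹ *ᵥ q) i - q i := by
  set p := (Matrix.scalar (Fin n) s - A)⁻¹ *ᵥ q with hp
  have hpq : (Matrix.scalar (Fin n) s - A) *ᵥ p = q := by
    rw [hp, Matrix.mulVec_mulVec, Matrix.mul_nonsing_inv _ (isUnit_det_scalar_sub hs),
      Matrix.one_mulVec]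
  have hi := congrFun hpq i
  rw [Matrix.sub_mulVec, Pi.sub_apply, Matrix.scalar_apply, Matrix.mulVec_diagonal] at hi
  linarith

theorem continuousOn_resolvent_mulVec (q : Fin n → ℝ) :
    ContinuousOn (fun s => (Matrix.scalar (Fin n) s - A)⁻¹ *ᵥ q) (Ioi (spectralAbscissa A)) := by
  have hcont : Continuous fun s : ℝ => Matrix.scalar (Fin n) s - A := by
    simp only [Matrix.scalar_apply]
    fun_prop
  simp only [Matrix.inv_def, Ring.inverse_eq_inv']
  have hdet : ContinuousOn (fun s => (Matrix.scalar (Fin n) s - A).det⁻¹)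
      (Ioi (spectralAbscissa A)) :=
    hcont.matrix_det.continuousOn.inv₀ fun s hs => (isUnit_det_scalar_sub hs).ne_zero
  have hmul : Continuous fun M : Matrix (Fin n) (Fin n) ℝ => M *ᵥ q :=
    continuous_id.matrix_mulVec continuous_const
  exact hmul.comp_continuousOn (hdet.smul hcont.matrix_adjugate.continuousOn)

-- The set of `s > α(A)` at which the resolvent vector is positive is nonempty, open and closed.
theorem IsMetzler.exists_pos_mulVec_lt (hA : IsMetzler A) {μ : ℝ} (hμ : spectralAbscissa A < μ) :
    ∃ p : Fin n → ℝ, (∀ i, 0 < p i) ∧ ∀ i, (A *ᵥ p) i < μ * p i := by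
  set p : ℝ → Fin n → ℝ := fun s => (Matrix.scalar (Fin n) s - A)⁻¹ *ᵥ 1
  set P : Set ℝ := Ioi (spectralAbscissa A) ∩ p ⁻¹' univ.pi fun _ => Ioi 0
  have hcont : ContinuousOn p (Ioi (spectralAbscissa A)) := continuousOn_resolvent_mulVec 1
  have hlt : ∀ s, spectralAbscissa A < s → ∀ i, (A *ᵥ p s) i < s * p s i := fun s hs i => by
    rw [mulVec_resolvent_apply hs]
    exact sub_lt_self _ one_pos
  have hpos : ∀ s, spectralAbscissa A < s → 0 ≤ p s → s ∈ P := fun s hs hps =>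
    ⟨hs, fun i _ => hA.pos_of_nonneg_of_mulVec_lt hps (hlt s hs) i⟩
  have hopen : IsOpen P :=
    hcont.isOpen_inter_preimage isOpen_Ioi (isOpen_set_pi finite_univ fun _ _ => isOpen_Ioi)
  have hnonempty : (Ioi (spectralAbscissa A) ∩ P).Nonempty := by
    obtain ⟨s, hs, hrow⟩ := ((eventually_gt_atTop (spectralAbscissa A)).and
      (eventually_all.2 fun i => eventually_gt_atTop (∑ j, A i j))).exists
    exact ⟨s, hs, hpos s hs (hA.nonneg_of_mulVec_le hrow fun i => (hlt s hs i).le)⟩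
  have hclosed : closure P ∩ Ioi (spectralAbscissa A) ⊆ P := by
    rintro s ⟨hsP, hs⟩
    refine hpos s hs fun i => ?_
    have hi : ContinuousWithinAt (fun r => p r i) P s :=
      (continuous_apply i).continuousAt.comp_continuousWithinAt
        ((hcont s hs).mono inter_subset_left)
    exact continuousWithinAt_const.closure_le (g := fun r => p r i) hsP hi
      fun r hr => (hr.2 i (mem_univ i)).le
  have hμP : μ ∈ P := isPreconnected_Ioi.subset_of_closure_inter_subset hopen hnonempty hclosed hμ
  exact ⟨p μ, fun i => hμP.2 i (mem_univ i), hlt μ hμ⟩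

theorem exists_pos_add_const_mulVec_lt {p q : Fin n → ℝ} (h : ∀ i, (A *ᵥ p) i < q i) :
    ∃ δ > 0, ∀ i, ((A + Matrix.of fun _ _ => δ) *ᵥ p) i < q i := by
  have hev : ∀ᶠ δ in 𝓝[>] (0 : ℝ), ∀ i, (A *ᵥ p) i + δ * ∑ j, p j < q i := by
    refine eventually_all.2 fun i => nhdsWithin_le_nhds ?_
    have hc : Continuous fun δ : ℝ => (A *ᵥ p) i + δ * ∑ j, p j := by fun_prop
    exact hc.continuousAt.eventually_lt_const (by simpa using h i)
  obtain ⟨δ, hδ, hδ0⟩ := (hev.and self_mem_nhdsWithin).exists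
  refine ⟨δ, hδ0, fun i => ?_⟩
  rw [Matrix.add_mulVec, Pi.add_apply]
  simpa [Matrix.mulVec, dotProduct, Finset.mul_sum] using hδ i

end Metzler

section IndefiniteIntegral

theorem nhdsLT_le_nhdsWithin_Icc {α : Type*} [LinearOrder α] [TopologicalSpace α]
    [OrderClosedTopology α] {a b t : α} (ht : t ∈ Ioc a b) : 𝓝[<] t ≤ 𝓝[Icc a b] t := by
  rw [← nhdsWithin_Ioo_eq_nhdsLT ht.1]
  exact nhdsWithin_mono t fun s hs => ⟨hs.1.le, hs.2.le.trans ht.2⟩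

variable {E F : Type*} [NormedAddCommGroup E] [NormedSpace ℝ E] [NormedAddCommGroup F]
  [NormedSpace ℝ F] {g h z y : ℝ → E} {a b : ℝ}

/-- `z` is an indefinite integral of `g` on `[a, b]`: the form in which solutions of differential
equations and their differences are handled, as `z` need not be differentiable anywhere. -/
structure IsIndefiniteIntegral (g z : ℝ → E) (a b : ℝ) : Prop where
  intervalIntegrable : IntervalIntegrable g volume a b
  eq_add_integral : ∀ t ∈ Icc a b, z t = z a + ∫ s in a..t, g s

namespace IsIndefiniteIntegral

theorem intervalIntegrable_of_mem (hz : IsIndefiniteIntegral g z a b) {r t : ℝ}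
    (hr : r ∈ Icc a b) (ht : t ∈ Icc a b) : IntervalIntegrable g volume r t :=
  hz.intervalIntegrable.mono_set
    (uIcc_subset_uIcc (Icc_subset_uIcc hr) (Icc_subset_uIcc ht))

theorem integral_eq_sub (hz : IsIndefiniteIntegral g z a b) {r t : ℝ} (hr : r ∈ Icc a b)
    (ht : t ∈ Icc a b) : ∫ s in r..t, g s = z t - z r := by
  have ha : a ∈ Icc a b := ⟨le_rfl, hr.1.trans hr.2⟩
  rw [hz.eq_add_integral t ht, hz.eq_add_integral r hr, add_sub_add_left_eq_sub,
    intervalIntegral.integral_interval_sub_left (hz.intervalIntegrable_of_mem ha ht)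
      (hz.intervalIntegrable_of_mem ha hr)]

theorem continuousOn (hz : IsIndefiniteIntegral g z a b) : ContinuousOn z (Icc a b) := by
  rcases lt_or_ge b a with hab | hab
  · rw [Icc_eq_empty hab.not_ge]
    exact continuousOn_empty _
  · have hint := intervalIntegral.continuousOn_primitive_interval' hz.intervalIntegrable
      left_mem_uIcc
    rw [uIcc_of_le hab] at hint
    exact (continuousOn_const.add hint).congr hz.eq_add_integral

theorem sub (hz : IsIndefiniteIntegral g z a b) (hy : IsIndefiniteIntegral h y a b) :
    IsIndefiniteIntegral (g - h) (z - y) a b where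
  intervalIntegrable := hz.intervalIntegrable.sub hy.intervalIntegrable
  eq_add_integral t ht := by
    have ha : a ∈ Icc a b := ⟨le_rfl, ht.1.trans ht.2⟩
    simp only [Pi.sub_apply]
    rw [intervalIntegral.integral_sub (hz.intervalIntegrable_of_mem ha ht)
      (hy.intervalIntegrable_of_mem ha ht), hz.integral_eq_sub ha ht, hy.integral_eq_sub ha ht]
    abel

theorem comp_clm [CompleteSpace E] [CompleteSpace F] (hz : IsIndefiniteIntegral g z a b)
    (L : E →L[ℝ] F) : IsIndefiniteIntegral (fun t => L (g t)) (fun t => L (z t)) a b where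
  intervalIntegrable := ⟨L.integrable_comp hz.intervalIntegrable.1,
    L.integrable_comp hz.intervalIntegrable.2⟩
  eq_add_integral t ht := by
    have ha : a ∈ Icc a b := ⟨le_rfl, ht.1.trans ht.2⟩
    rw [L.intervalIntegral_comp_comm (hz.intervalIntegrable_of_mem ha ht),
      hz.integral_eq_sub ha ht, map_sub, add_sub_cancel]

theorem eventually_abs_sub_abs_le_integral {x g h : ℝ → ℝ} (hx : IsIndefiniteIntegral g x a b)
    {T : ℝ} (hT : T ∈ Ioc a b) (hxT : x T ≠ 0) (hh : IntervalIntegrable h volume a b)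
    (hgh : ∀ᶠ s in 𝓝[<] T, x s * g s ≤ |x s| * h s) :
    ∀ᶠ r in 𝓝[<] T, |x T| - |x r| ≤ ∫ s in r..T, h s := by
  wlog hpos : 0 < x T generalizing x g
  · have hneg := hx.comp_clm (-ContinuousLinearMap.id ℝ ℝ)
    simp only [neg_apply, ContinuousLinearMap.id_apply] at hneg
    simpa only [abs_neg] using this hneg (neg_ne_zero.2 hxT)
      (by simpa only [neg_mul_neg, abs_neg] using hgh)
      (neg_pos.2 (hxT.lt_of_le (not_lt.1 hpos)))
  have hxpos : ∀ᶠ s in 𝓝[<] T, 0 < x s :=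
    ((hx.continuousOn T (Ioc_subset_Icc_self hT)).mono_left
      (nhdsLT_le_nhdsWithin_Icc hT)).eventually (lt_mem_nhds hpos)
  obtain ⟨l, hl, hlT⟩ := (mem_nhdsLT_iff_exists_Ioo_subset' hT.1).1
    ((hxpos.and hgh).and (Ioo_mem_nhdsLT hT.1))
  filter_upwards [Ioo_mem_nhdsLT hl] with r hr
  have hrT : r ∈ Icc a b := ⟨(hlT hr).2.1.le, hr.2.le.trans hT.2⟩
  calc |x T| - |x r| = x T - x r := by rw [abs_of_pos hpos, abs_of_pos (hlT hr).1.1]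
    _ = ∫ s in r..T, g s := (hx.integral_eq_sub hrT (Ioc_subset_Icc_self hT)).symm
    _ ≤ ∫ s in r..T, h s := by
      refine intervalIntegral.integral_mono_on_of_le_Ioo hr.2.le
        (hx.intervalIntegrable_of_mem hrT (Ioc_subset_Icc_self hT))
        (hh.mono_set (uIcc_subset_uIcc (Icc_subset_uIcc hrT)
          (Icc_subset_uIcc (Ioc_subset_Icc_self hT)))) fun s hs => ?_
      obtain ⟨⟨hs0, hgs⟩, -⟩ := hlT ⟨hr.1.trans hs.1, hs.2⟩
      rw [abs_of_pos hs0] at hgs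
      exact le_of_mul_le_mul_left hgs hs0

end IsIndefiniteIntegral

end IndefiniteIntegral

section Comparison

variable {n : ℕ} {B : Matrix (Fin n) (Fin n) ℝ} {a b μ : ℝ}

theorem exists_first_crossing {ι : Type*} [Finite ι] {u w : ι → ℝ → ℝ}
    (hu : ∀ i, ContinuousOn (u i) (Icc a b)) (hw : ∀ i, ContinuousOn (w i) (Icc a b))
    (h0 : ∀ i, u i a < w i a) (h : ∃ t ∈ Icc a b, ∃ i, w i t ≤ u i t) :
    ∃ T ∈ Ioc a b, (∀ s ∈ Ico a T, ∀ j, u j s < w j s) ∧ (∀ j, u j T ≤ w j T) ∧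
      ∃ i, u i T = w i T := by
  have hcompact : IsCompact (⋃ i, {t ∈ Icc a b | w i t ≤ u i t}) :=
    isCompact_iUnion fun i => isCompact_Icc.of_isClosed_subset
      (isClosed_Icc.isClosed_le (hw i) (hu i)) (sep_subset _ _)
  obtain ⟨t, ht, i, hi⟩ := h
  obtain ⟨T, hTmem, hTmin⟩ := hcompact.exists_isLeast ⟨t, mem_iUnion.2 ⟨i, ht, hi⟩⟩
  obtain ⟨i, hT, hi⟩ := mem_iUnion.1 hTmem
  have haT : a < T := hT.1.lt_of_ne fun haT => (h0 i).not_ge (haT ▸ hi)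
  have hbefore : ∀ s ∈ Ico a T, ∀ j, u j s < w j s := fun s hs j =>
    lt_of_not_ge fun hj =>
      (hTmin (mem_iUnion.2 ⟨j, ⟨hs.1, hs.2.le.trans hT.2⟩, hj⟩)).not_gt hs.2
  have hle : ∀ j, u j T ≤ w j T := fun j => by
    have hsub : Ico a T ⊆ Icc a b := fun s hs => ⟨hs.1, hs.2.le.trans hT.2⟩
    refine ((hu j T hT).mono hsub).closure_le ?_ ((hw j T hT).mono hsub)
      fun s hs => (hbefore s hs j).le
    rw [closure_Ico haT.ne]
    exact right_mem_Icc.2 haT.le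
  exact ⟨T, ⟨haT, hT.2⟩, hbefore, hle, i, (hle i).antisymm hi⟩

theorem IsIndefiniteIntegral.abs_lt_of_strict_supersolution {z g w w' : ℝ → Fin n → ℝ}
    (hz : IsIndefiniteIntegral g z a b) (hB : IsMetzler B)
    (hineq : ∀ s ∈ Ico a b, ∀ i, z s i * g s i ≤ |z s i| * (B *ᵥ |z s|) i)
    (hw : ∀ t, HasDerivAt w (w' t) t) (hw' : Continuous w')
    (hwpos : ∀ t ∈ Icc a b, ∀ i, 0 < w t i) (hBw : ∀ t ∈ Icc a b, ∀ i, (B *ᵥ w t) i < w' t i)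
    (h0 : ∀ i, |z a i| < w a i) : ∀ t ∈ Icc a b, ∀ i, |z t i| < w t i := by
  by_contra! hcross
  have hzc : ∀ i, ContinuousOn (fun t => z t i) (Icc a b) := continuousOn_pi.1 hz.continuousOn
  have hwc : Continuous w := continuous_iff_continuousAt.2 fun t => (hw t).continuousAt
  obtain ⟨T, hT, hbefore, hle, i, hi⟩ := exists_first_crossing (u := fun i t => |z t i|)
    (w := fun i t => w t i) (fun i => (hzc i).abs) (by fun_prop) h0 hcross
  have hTmem : T ∈ Icc a b := Ioc_subset_Icc_self hT
  have hzT : z T i ≠ 0 := abs_pos.1 (hi ▸ hwpos T hTmem i)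
  have hslope : ∀ᶠ s in 𝓝[<] T, z s i * g s i ≤ |z s i| * w' s i := by
    have hstrict : (B *ᵥ |z T|) i < w' T i := (hB.mulVec_le_mulVec hle hi).trans_lt (hBw T hTmem i)
    have hcont : Continuous fun v : Fin n → ℝ => (B *ᵥ |v|) i := by
      simp only [Matrix.mulVec, dotProduct, Pi.abs_apply]
      fun_prop
    have hlim : Tendsto (fun s => (B *ᵥ |z s|) i) (𝓝[<] T) (𝓝 ((B *ᵥ |z T|) i)) :=
      (hcont.tendsto (z T)).comp
        ((hz.continuousOn T hTmem).mono_left (nhdsLT_le_nhdsWithin_Icc hT))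
    have hlim' : Tendsto (fun s => w' s i) (𝓝[<] T) (𝓝 (w' T i)) :=
      (((continuous_apply i).comp hw').tendsto T).mono_left nhdsWithin_le_nhds
    filter_upwards [hlim.eventually_lt hlim' hstrict, Ioo_mem_nhdsLT hT.1] with s hs hsT
    exact (hineq s ⟨hsT.1.le, hsT.2.trans_le hT.2⟩ i).trans (by gcongr)
  have hint : ∀ r, ∫ s in r..T, w' s i = w T i - w r i := fun r =>
    intervalIntegral.integral_eq_sub_of_hasDerivAt (fun s _ => hasDerivAt_pi.1 (hw s) i)
      (Continuous.intervalIntegrable (by fun_prop) _ _)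
  have hzi : IsIndefiniteIntegral (fun t => g t i) (fun t => z t i) a b :=
    hz.comp_clm (ContinuousLinearMap.proj (R := ℝ) (φ := fun _ : Fin n => ℝ) i)
  obtain ⟨r, hr, hrT⟩ := ((hzi.eventually_abs_sub_abs_le_integral hT hzT
    (Continuous.intervalIntegrable (by fun_prop) _ _) hslope).and (Ioo_mem_nhdsLT hT.1)).exists
  rw [hint] at hr
  linarith [hbefore r ⟨hrT.1.le, hrT.2⟩ i]

theorem IsIndefiniteIntegral.abs_le_mul_exp {z g : ℝ → Fin n → ℝ}
    (hz : IsIndefiniteIntegral g z a b) (hB : IsMetzler B)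
    (hineq : ∀ s ∈ Ico a b, ∀ i, z s i * g s i ≤ |z s i| * (B *ᵥ |z s|) i)
    {p : Fin n → ℝ} (hp : ∀ i, 0 < p i) (hBp : ∀ i, (B *ᵥ p) i < μ * p i)
    {c : ℝ} (h0 : ∀ i, |z a i| ≤ c * p i) {t : ℝ} (ht : t ∈ Icc a b) (i : Fin n) :
    |z t i| ≤ c * (Real.exp (μ * (t - a)) * p i) := by
  have hc : 0 ≤ c := nonneg_of_mul_nonneg_left ((abs_nonneg _).trans (h0 i)) (hp i)
  have hpi := hp i
  rw [← div_le_iff₀ (by positivity)]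
  refine le_of_forall_gt_imp_ge_of_dense fun d hd => ?_
  rw [div_le_iff₀ (by positivity), ← mul_assoc]
  have hd0 : 0 < d := hc.trans_lt hd
  refine (hz.abs_lt_of_strict_supersolution hB hineq
    (w := fun t => (d * Real.exp (μ * (t - a))) • p)
    (w' := fun t => (μ * (d * Real.exp (μ * (t - a)))) • p) (fun t => ?_) (by fun_prop)
    (fun t _ j => ?_) (fun t _ j => ?_) (fun j => ?_) t ht i).le
  · have hexp : HasDerivAt (fun t => Real.exp (μ * (t - a))) (Real.exp (μ * (t - a)) * μ) t := by
      simpa using (((hasDerivAt_id t).sub_const a).const_mul μ).exp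
    exact ((hexp.const_mul d).congr_deriv (by ring)).smul_const p
  · exact mul_pos (by positivity) (hp j)
  · rw [Matrix.mulVec_smul]
    calc d * Real.exp (μ * (t - a)) * (B *ᵥ p) j
        < d * Real.exp (μ * (t - a)) * (μ * p j) :=
          mul_lt_mul_of_pos_left (hBp j) (by positivity)
      _ = μ * (d * Real.exp (μ * (t - a))) * p j := by ring
  · simpa using (h0 j).trans_lt (mul_lt_mul_of_pos_right hd (hp j))

theorem exists_norm_le_mul_exp_of_isIndefiniteIntegral (hB : IsMetzler B) {p : Fin n → ℝ}
    (hp : ∀ i, 0 < p i) (hBp : ∀ i, (B *ᵥ p) i < μ * p i) :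
    ∃ M > 0, ∀ (z g : ℝ → Fin n → ℝ) (a b : ℝ), IsIndefiniteIntegral g z a b →
      (∀ s ∈ Ico a b, ∀ i, z s i * g s i ≤ |z s i| * (B *ᵥ |z s|) i) →
      ∀ t ∈ Icc a b, ‖z t‖ ≤ M * Real.exp (μ * (t - a)) * ‖z a‖ := by
  obtain ⟨m, hm0, hm⟩ : ∃ m > 0, ∀ i, m ≤ p i := by
    rcases isEmpty_or_nonempty (Fin n) with _ | _
    · exact ⟨1, one_pos, isEmptyElim⟩
    · obtain ⟨k, hk⟩ := Finite.exists_min p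
      exact ⟨p k, hp k, hk⟩
  refine ⟨(‖p‖ + 1) / m, by positivity, fun z g a b hz hineq t ht => ?_⟩
  refine (pi_norm_le_iff_of_nonneg (by positivity)).2 fun i => ?_
  have h0 : ∀ j, |z a j| ≤ ‖z a‖ / m * p j := fun j =>
    calc |z a j| ≤ ‖z a‖ / m * m := by
          rw [div_mul_cancel₀ _ hm0.ne']
          exact norm_le_pi_norm (z a) j
      _ ≤ ‖z a‖ / m * p j := by gcongr; exact hm j
  have hpi : p i ≤ ‖p‖ + 1 := (le_abs_self _).trans ((norm_le_pi_norm p i).trans (by linarith))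
  calc |z t i| ≤ ‖z a‖ / m * (Real.exp (μ * (t - a)) * p i) :=
        hz.abs_le_mul_exp hB hineq hp hBp h0 ht i
    _ ≤ ‖z a‖ / m * (Real.exp (μ * (t - a)) * (‖p‖ + 1)) := by gcongr
    _ = (‖p‖ + 1) / m * Real.exp (μ * (t - a)) * ‖z a‖ := by ring

end Comparison

section Flow

variable {n : ℕ} {f : ℝ → (Fin n → ℝ) → (Fin n → ℝ)} {t₀ : ℝ}

theorem fderiv_apply_eq_sum_partialDeriv (t : ℝ) (v w : Fin n → ℝ) (i : Fin n) :
    fderiv ℝ (f t) v w i = ∑ j, partialDeriv f i j t v * w j := by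
  conv_lhs => rw [pi_eq_sum_univ' w, map_sum]
  simp [partialDeriv, mul_comm, Pi.single]

theorem abs_partialDeriv_le (i j : Fin n) (t : ℝ) (v : Fin n → ℝ) :
    |partialDeriv f i j t v| ≤ ‖fderiv ℝ (f t) v‖ :=
  calc |partialDeriv f i j t v| ≤ ‖fderiv ℝ (f t) v (Pi.single j 1)‖ :=
        norm_le_pi_norm (fderiv ℝ (f t) v (Pi.single j 1)) i
    _ ≤ ‖fderiv ℝ (f t) v‖ * ‖(Pi.single j 1 : Fin n → ℝ)‖ := ContinuousLinearMap.le_opNorm _ _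
    _ = ‖fderiv ℝ (f t) v‖ := by rw [Pi.norm_single, norm_one, mul_one]

/-- The diagonal entries of the Jacobian of `f t` at `v` are bounded by those of `B`, and its
off-diagonal entries are bounded in absolute value by those of `B`. -/
def JacobianLe (f : ℝ → (Fin n → ℝ) → (Fin n → ℝ)) (B : Matrix (Fin n) (Fin n) ℝ) (t : ℝ)
    (v : Fin n → ℝ) : Prop :=
  (∀ i, partialDeriv f i i t v ≤ B i i) ∧ ∀ i j, i ≠ j → |partialDeriv f i j t v| ≤ B i j

/-- The Jacobian of `f` with respect to the state is bounded on bounded time intervals and compact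
sets of states. -/
def HasLocallyBoundedJacobian (f : ℝ → (Fin n → ℝ) → (Fin n → ℝ)) (t₀ : ℝ) : Prop :=
  ∀ (T : ℝ) (C : Set (Fin n → ℝ)), IsCompact C →
    ∃ L : ℝ, ∀ t ∈ Icc t₀ T, ∀ x ∈ C, ‖fderiv ℝ (f t) x‖ ≤ L

theorem jacobianLe_of_norm_fderiv_le {L t : ℝ} {v : Fin n → ℝ} (h : ‖fderiv ℝ (f t) v‖ ≤ L) :
    JacobianLe f (Matrix.of fun _ _ => L) t v :=
  ⟨fun i => (le_abs_self _).trans ((abs_partialDeriv_le i i t v).trans h),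
    fun i j _ => (abs_partialDeriv_le i j t v).trans h⟩

theorem JacobianLe.mul_fderiv_apply_le {B : Matrix (Fin n) (Fin n) ℝ} {t : ℝ} {v : Fin n → ℝ}
    (h : JacobianLe f B t v) (w : Fin n → ℝ) (i : Fin n) :
    w i * fderiv ℝ (f t) v w i ≤ |w i| * (B *ᵥ |w|) i := by
  rw [fderiv_apply_eq_sum_partialDeriv, Matrix.mulVec, dotProduct, Finset.mul_sum, Finset.mul_sum]
  refine Finset.sum_le_sum fun j _ => ?_
  rw [Pi.abs_apply]
  by_cases hij : i = j
  · subst hij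
    calc w i * (partialDeriv f i i t v * w i) = partialDeriv f i i t v * (w i * w i) := by ring
      _ ≤ B i i * (w i * w i) := mul_le_mul_of_nonneg_right (h.1 i) (mul_self_nonneg _)
      _ = |w i| * (B i i * |w i|) := by rw [← abs_mul_abs_self (w i)]; ring
  · calc w i * (partialDeriv f i j t v * w j) ≤ |w i * (partialDeriv f i j t v * w j)| :=
          le_abs_self _
      _ = |w i| * (|partialDeriv f i j t v| * |w j|) := by rw [abs_mul, abs_mul]
      _ ≤ |w i| * (B i j * |w j|) := by gcongr; exact h.2 i j hij

theorem sub_mul_sub_le_of_jacobianLe {B : Matrix (Fin n) (Fin n) ℝ} {t : ℝ}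
    (hf : Differentiable ℝ (f t)) {x y : Fin n → ℝ}
    (h : ∀ v ∈ segment ℝ x y, JacobianLe f B t v) (i : Fin n) :
    (y - x) i * (f t y - f t x) i ≤ |(y - x) i| * (B *ᵥ |y - x|) i := by
  obtain ⟨v, hv, hmv⟩ := domain_mvt
    (fun u _ => ((hasFDerivAt_pi'.1 (hf u).hasFDerivAt) i).hasFDerivWithinAt)
    (convex_segment x y) (left_mem_segment ℝ x y) (right_mem_segment ℝ x y)
  rw [Pi.sub_apply (f t y), hmv]
  exact (h v hv).mul_fderiv_apply_le (y - x) i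

theorem IsSolution.apply_left {x : Fin n → ℝ} {φ : ℝ → Fin n → ℝ} (hφ : IsSolution f t₀ x φ) :
    φ t₀ = x := by
  simpa using (hφ.2 t₀ le_rfl).2

theorem IsSolution.isIndefiniteIntegral {x : Fin n → ℝ} {φ : ℝ → Fin n → ℝ}
    (hφ : IsSolution f t₀ x φ) {a b : ℝ} (ha : t₀ ≤ a) (hab : a ≤ b) :
    IsIndefiniteIntegral (fun s => f s (φ s)) φ a b where
  intervalIntegrable := (hφ.2 a ha).1.symm.trans (hφ.2 b (ha.trans hab)).1
  eq_add_integral t ht := by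
    have hat := ha.trans ht.1
    rw [(hφ.2 t hat).2, (hφ.2 a ha).2, add_assoc,
      intervalIntegral.integral_add_adjacent_intervals (hφ.2 a ha).1
        ((hφ.2 a ha).1.symm.trans (hφ.2 t hat).1)]

theorem isSolution_flow {x : Fin n → ℝ} (h : ∃ φ, IsSolution f t₀ x φ) :
    IsSolution f t₀ x (fun t => flow f t₀ t x) := by
  simp only [flow, dif_pos h]
  exact h.choose_spec

theorem exists_norm_sub_le_of_jacobianLe (hfd : ∀ t, t₀ ≤ t → Differentiable ℝ (f t))
    {B : Matrix (Fin n) (Fin n) ℝ} (hB : IsMetzler B) {p : Fin n → ℝ} (hp : ∀ i, 0 < p i) {μ : ℝ}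
    (hBp : ∀ i, (B *ᵥ p) i < μ * p i) :
    ∃ M > 0, ∀ (x y : Fin n → ℝ) (φ ψ : ℝ → Fin n → ℝ) (a b : ℝ), t₀ ≤ a →
      IsSolution f t₀ x φ → IsSolution f t₀ y ψ →
      (∀ s ∈ Ico a b, ∀ v ∈ segment ℝ (φ s) (ψ s), JacobianLe f B s v) →
      ∀ t ∈ Icc a b, ‖ψ t - φ t‖ ≤ M * Real.exp (μ * (t - a)) * ‖ψ a - φ a‖ := by
  obtain ⟨M, hM0, hM⟩ := exists_norm_le_mul_exp_of_isIndefiniteIntegral hB hp hBp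
  refine ⟨M, hM0, fun x y φ ψ a b ha hφ hψ hJ t ht => ?_⟩
  have hab : a ≤ b := ht.1.trans ht.2
  exact hM _ _ a b ((hψ.isIndefiniteIntegral ha hab).sub (hφ.isIndefiniteIntegral ha hab))
    (fun s hs => sub_mul_sub_le_of_jacobianLe (hfd s (ha.trans hs.1)) (hJ s hs)) t ht

theorem exists_norm_sub_le_of_segment_subset (hfd : ∀ t, t₀ ≤ t → Differentiable ℝ (f t))
    (hJ : HasLocallyBoundedJacobian f t₀) {C : Set (Fin n → ℝ)} (hC : IsCompact C) (T : ℝ) :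
    ∃ M > 0, ∀ (x y : Fin n → ℝ) (φ ψ : ℝ → Fin n → ℝ), ∀ b ≤ T,
      IsSolution f t₀ x φ → IsSolution f t₀ y ψ →
      (∀ s ∈ Ico t₀ b, segment ℝ (φ s) (ψ s) ⊆ C) →
      ∀ t ∈ Icc t₀ b, ‖ψ t - φ t‖ ≤ M * ‖y - x‖ := by
  obtain ⟨L, hL⟩ := hJ T C hC
  set L' := max L 0
  obtain ⟨M, hM0, hM⟩ := exists_norm_sub_le_of_jacobianLe hfd (B := Matrix.of fun _ _ => L')
    (p := 1) (μ := n * L' + 1) (fun _ _ _ => le_max_right _ _) (fun _ => one_pos)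
    (fun i => by simp [Matrix.mulVec, dotProduct])
  refine ⟨M * Real.exp ((n * L' + 1) * (T - t₀)), by positivity,
    fun x y φ ψ b hb hφ hψ hseg t ht => ?_⟩
  have hJL : ∀ s ∈ Ico t₀ b, ∀ v ∈ segment ℝ (φ s) (ψ s),
      JacobianLe f (Matrix.of fun _ _ => L') s v := fun s hs v hv =>
    jacobianLe_of_norm_fderiv_le
      ((hL s ⟨hs.1, hs.2.le.trans hb⟩ v (hseg s hs hv)).trans (le_max_left _ _))
  have htT : t ≤ T := ht.2.trans hb
  calc ‖ψ t - φ t‖ ≤ M * Real.exp ((n * L' + 1) * (t - t₀)) * ‖ψ t₀ - φ t₀‖ :=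
        hM x y φ ψ t₀ b le_rfl hφ hψ hJL t ht
    _ ≤ M * Real.exp ((n * L' + 1) * (T - t₀)) * ‖y - x‖ := by
        rw [hφ.apply_left, hψ.apply_left]
        gcongr

theorem exists_ball_forall_norm_sub_lt (hfd : ∀ t, t₀ ≤ t → Differentiable ℝ (f t))
    (hJ : HasLocallyBoundedJacobian f t₀) (T : ℝ) {ρ : ℝ} (hρ : 0 < ρ) {x : Fin n → ℝ}
    {φ : ℝ → Fin n → ℝ} (hφ : IsSolution f t₀ x φ) :
    ∃ r > 0, ∀ y ∈ Metric.ball x r, ∀ ψ, IsSolution f t₀ y ψ → ∀ t ∈ Icc t₀ T,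
      ‖ψ t - φ t‖ < ρ := by
  have himg : IsCompact (φ '' Icc t₀ T) :=
    isCompact_Icc.image_of_continuousOn (hφ.1.mono Icc_subset_Ici_self)
  obtain ⟨M, hM0, hM⟩ := exists_norm_sub_le_of_segment_subset hfd hJ (himg.cthickening (r := ρ)) T
  refine ⟨min ρ (ρ / M), by positivity, fun y hy ψ hψ => ?_⟩
  rw [Metric.mem_ball, dist_eq_norm, lt_min_iff, lt_div_iff₀' hM0] at hy
  by_contra! hexit
  have hcont : ContinuousOn (fun t => ‖ψ t - φ t‖) (Icc t₀ T) :=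
    ((hψ.1.sub hφ.1).mono Icc_subset_Ici_self).norm
  obtain ⟨b, hb, hbefore, -, -, hbρ⟩ := exists_first_crossing (ι := Unit)
    (u := fun _ t => ‖ψ t - φ t‖) (w := fun _ _ => ρ) (fun _ => hcont)
    (fun _ => continuousOn_const) (fun _ => by rw [hφ.apply_left, hψ.apply_left]; exact hy.1)
    (hexit.imp fun t ht => ⟨ht.1, (), ht.2⟩)
  have htube : ∀ s ∈ Ico t₀ b, segment ℝ (φ s) (ψ s) ⊆ Metric.cthickening ρ (φ '' Icc t₀ T) := by
    intro s hs
    have hball : segment ℝ (φ s) (ψ s) ⊆ Metric.closedBall (φ s) ρ :=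
      (convex_closedBall _ _).segment_subset (Metric.mem_closedBall_self hρ.le)
        (mem_closedBall_iff_norm.2 (hbefore s hs ()).le)
    have hsT : s ∈ Icc t₀ T := ⟨hs.1, hs.2.le.trans hb.2⟩
    exact hball.trans (Metric.closedBall_subset_cthickening (mem_image_of_mem φ hsT) ρ)
  have hexit_lt : ‖ψ b - φ b‖ < ρ :=
    (hM x y φ ψ b hb.2 hφ hψ htube b (right_mem_Icc.2 hb.1.le)).trans_lt hy.2
  exact hexit_lt.ne hbρ

theorem exists_norm_flow_le (hfd : ∀ t, t₀ ≤ t → Differentiable ℝ (f t))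
    (hJ : HasLocallyBoundedJacobian f t₀) {K : Set (Fin n → ℝ)} (hK : IsCompact K)
    (hsol : ∀ x ∈ K, ∃ φ, IsSolution f t₀ x φ) (T : ℝ) :
    ∃ R : ℝ, ∀ x ∈ K, ∀ t ∈ Icc t₀ T, ‖flow f t₀ t x‖ ≤ R := by
  choose! r hr0 hr using fun x (hx : x ∈ K) =>
    exists_ball_forall_norm_sub_lt hfd hJ T one_pos (isSolution_flow (hsol x hx))
  choose! R hR using fun x (hx : x ∈ K) =>
    (isCompact_Icc (a := t₀) (b := T)).exists_bound_of_continuousOn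
      ((isSolution_flow (hsol x hx)).1.mono Icc_subset_Ici_self)
  obtain ⟨s, hsK, hs⟩ := hK.elim_nhds_subcover (fun x => Metric.ball x (r x))
    fun x hx => Metric.ball_mem_nhds x (hr0 x hx)
  obtain ⟨R', hR'⟩ := (s.image R).exists_le
  refine ⟨R' + 1, fun y hy t ht => ?_⟩
  obtain ⟨x, hxs, hyx⟩ := mem_iUnion₂.1 (hs hy)
  have hxK := hsK x hxs
  calc ‖flow f t₀ t y‖ ≤ ‖flow f t₀ t x‖ + ‖flow f t₀ t y - flow f t₀ t x‖ :=
        norm_le_norm_add_norm_sub' _ _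
    _ ≤ R' + 1 := add_le_add ((hR x hxK t ht).trans (hR' _ (Finset.mem_image_of_mem R hxs)))
        (hr x hxK y hyx _ (isSolution_flow (hsol y hy)) t ht).le

theorem exists_norm_flow_sub_le (hfd : ∀ t, t₀ ≤ t → Differentiable ℝ (f t))
    (hJ : HasLocallyBoundedJacobian f t₀) {K : Set (Fin n → ℝ)} (hK : IsCompact K)
    (hsol : ∀ x ∈ K, ∃ φ, IsSolution f t₀ x φ) (T : ℝ) :
    ∃ M > 0, ∀ x ∈ K, ∀ y ∈ K, ∀ t ∈ Icc t₀ T,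
      ‖flow f t₀ t y - flow f t₀ t x‖ ≤ M * ‖y - x‖ := by
  obtain ⟨R, hR⟩ := exists_norm_flow_le hfd hJ hK hsol T
  obtain ⟨M, hM0, hM⟩ := exists_norm_sub_le_of_segment_subset hfd hJ
    (isCompact_closedBall (0 : Fin n → ℝ) R) T
  have hmem : ∀ x ∈ K, ∀ s ∈ Ico t₀ T, flow f t₀ s x ∈ Metric.closedBall 0 R := fun x hx s hs =>
    mem_closedBall_zero_iff.2 (hR x hx s (Ico_subset_Icc_self hs))
  exact ⟨M, hM0, fun x hx y hy => hM x y _ _ T le_rfl (isSolution_flow (hsol x hx))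
    (isSolution_flow (hsol y hy)) fun s hs =>
      (convex_closedBall _ _).segment_subset (hmem x hx s hs) (hmem y hy s hs)⟩

theorem exists_norm_flow_sub_le_exp_of_eventually_jacobianLe
    (hfd : ∀ t, t₀ ≤ t → Differentiable ℝ (f t)) (hJ : HasLocallyBoundedJacobian f t₀)
    {K : Set (Fin n → ℝ)} (hK : Bornology.IsBounded K)
    (hsol : ∀ x ∈ closure K, ∃ φ, IsSolution f t₀ x φ)
    {B : Matrix (Fin n) (Fin n) ℝ} (hB : IsMetzler B) {p : Fin n → ℝ} (hp : ∀ i, 0 < p i) {μ : ℝ}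
    (hBp : ∀ i, (B *ᵥ p) i < μ * p i) (hμ : 0 ≤ μ)
    (hJB : ∀ᶠ t in atTop, ∀ v ∈ convexHull ℝ (reach f t₀ t K), JacobianLe f B t v) :
    ∃ M > 0, ∀ x ∈ K, ∀ y ∈ K, ∀ t, t₀ ≤ t →
      ‖flow f t₀ t y - flow f t₀ t x‖ ≤ M * Real.exp (μ * (t - t₀)) * ‖y - x‖ := by
  obtain ⟨T, hT, hTJ⟩ := (atTop_basis' t₀).eventually_iff.1 hJB
  obtain ⟨M₁, hM₁0, hM₁⟩ := exists_norm_flow_sub_le hfd hJ hK.isCompact_closure hsol T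
  obtain ⟨M₂, hM₂0, hM₂⟩ := exists_norm_sub_le_of_jacobianLe hfd hB hp hBp
  refine ⟨max M₁ (M₂ * M₁), by positivity, fun x hx y hy t ht => ?_⟩
  have hxc := subset_closure hx
  have hyc := subset_closure hy
  rcases le_total t T with htT | hTt
  · have hexp : 1 ≤ Real.exp (μ * (t - t₀)) :=
      Real.one_le_exp (mul_nonneg hμ (sub_nonneg.2 ht))
    calc ‖flow f t₀ t y - flow f t₀ t x‖ ≤ M₁ * ‖y - x‖ := hM₁ x hxc y hyc t ⟨ht, htT⟩
      _ = M₁ * 1 * ‖y - x‖ := by rw [mul_one]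
      _ ≤ max M₁ (M₂ * M₁) * Real.exp (μ * (t - t₀)) * ‖y - x‖ := by
          gcongr
          exact le_max_left _ _
  · have hseg : ∀ s ∈ Ico T t, ∀ v ∈ segment ℝ (flow f t₀ s x) (flow f t₀ s y),
        JacobianLe f B s v := fun s hs v hv =>
      hTJ hs.1 v (segment_subset_convexHull (mem_image_of_mem _ hx) (mem_image_of_mem _ hy) hv)
    calc ‖flow f t₀ t y - flow f t₀ t x‖
        ≤ M₂ * Real.exp (μ * (t - T)) * ‖flow f t₀ T y - flow f t₀ T x‖ :=
          hM₂ x y _ _ T t hT (isSolution_flow (hsol x hxc)) (isSolution_flow (hsol y hyc)) hseg t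
            (right_mem_Icc.2 hTt)
      _ ≤ M₂ * Real.exp (μ * (t - t₀)) * (M₁ * ‖y - x‖) := by
          gcongr
          exact hM₁ x hxc y hyc T (right_mem_Icc.2 hT)
      _ = M₂ * M₁ * Real.exp (μ * (t - t₀)) * ‖y - x‖ := by ring
      _ ≤ max M₁ (M₂ * M₁) * Real.exp (μ * (t - t₀)) * ‖y - x‖ := by
          gcongr
          exact le_max_right _ _

theorem eventually_forall_le_of_limsup_biSup_le {α β : Type*} {l : Filter α} {S : α → Set β}
    {u : α → β → ℝ} {c d : ℝ} (h : limsup (fun t => ⨆ v ∈ S t, (u t v : EReal)) l ≤ c)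
    (hcd : c < d) : ∀ᶠ t in l, ∀ v ∈ S t, u t v ≤ d := by
  filter_upwards [eventually_lt_of_limsup_lt (h.trans_lt (EReal.coe_lt_coe hcd))] with t ht v hv
  exact EReal.coe_le_coe_iff.1 ((le_iSup₂ (f := fun v (_ : v ∈ S t) => (u t v : EReal)) v hv).trans
    ht.le)

theorem eventually_jacobianLe_add_const {K : Set (Fin n → ℝ)} {A : Matrix (Fin n) (Fin n) ℝ}
    (hdiag : ∀ i, limsup (fun t : ℝ => ⨆ v ∈ convexHull ℝ (reach f t₀ t K),
      ((partialDeriv f i i t v : ℝ) : EReal)) atTop ≤ ((A i i : ℝ) : EReal))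
    (hoff : ∀ i j, i ≠ j → limsup (fun t : ℝ => ⨆ v ∈ convexHull ℝ (reach f t₀ t K),
      ((|partialDeriv f i j t v| : ℝ) : EReal)) atTop ≤ ((A i j : ℝ) : EReal))
    {δ : ℝ} (hδ : 0 < δ) :
    ∀ᶠ t in atTop, ∀ v ∈ convexHull ℝ (reach f t₀ t K),
      JacobianLe f (A + Matrix.of fun _ _ => δ) t v := by
  have hdiag' : ∀ᶠ t in atTop, ∀ i, ∀ v ∈ convexHull ℝ (reach f t₀ t K),
      partialDeriv f i i t v ≤ A i i + δ :=
    eventually_all.2 fun i =>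
      eventually_forall_le_of_limsup_biSup_le (hdiag i) (lt_add_of_pos_right _ hδ)
  have hoff' : ∀ᶠ t in atTop, ∀ i j, i ≠ j → ∀ v ∈ convexHull ℝ (reach f t₀ t K),
      |partialDeriv f i j t v| ≤ A i j + δ :=
    eventually_all.2 fun i => eventually_all.2 fun j => eventually_imp_distrib_left.2 fun hij =>
      eventually_forall_le_of_limsup_biSup_le (hoff i j hij) (lt_add_of_pos_right _ hδ)
  filter_upwards [hdiag', hoff'] with t hd ho v hv
  exact ⟨fun i => hd i v hv, fun i j hij => ho i j hij v hv⟩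

theorem exists_norm_flow_sub_le_exp (hfd : ∀ t, t₀ ≤ t → Differentiable ℝ (f t))
    (hJ : HasLocallyBoundedJacobian f t₀) {K : Set (Fin n → ℝ)} (hK : Bornology.IsBounded K)
    (hsol : ∀ x ∈ closure K, ∃ φ, IsSolution f t₀ x φ)
    {A : Matrix (Fin n) (Fin n) ℝ} (hA : IsMetzler A)
    (hdiag : ∀ i, limsup (fun t : ℝ => ⨆ v ∈ convexHull ℝ (reach f t₀ t K),
      ((partialDeriv f i i t v : ℝ) : EReal)) atTop ≤ ((A i i : ℝ) : EReal))
    (hoff : ∀ i j, i ≠ j → limsup (fun t : ℝ => ⨆ v ∈ convexHull ℝ (reach f t₀ t K),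
      ((|partialDeriv f i j t v| : ℝ) : EReal)) atTop ≤ ((A i j : ℝ) : EReal))
    {μ : ℝ} (hμ : 0 ≤ μ) (hAμ : spectralAbscissa A < μ) :
    ∃ M > 0, ∀ x ∈ K, ∀ y ∈ K, ∀ t, t₀ ≤ t →
      ‖flow f t₀ t y - flow f t₀ t x‖ ≤ M * Real.exp (μ * (t - t₀)) * ‖y - x‖ := by
  obtain ⟨p, hp, hAp⟩ := hA.exists_pos_mulVec_lt hAμ
  obtain ⟨δ, hδ, hBp⟩ := exists_pos_add_const_mulVec_lt hAp
  have hB : IsMetzler (A + Matrix.of fun _ _ => δ) := fun i j hij =>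
    add_nonneg (hA i j hij) hδ.le
  exact exists_norm_flow_sub_le_exp_of_eventually_jacobianLe hfd hJ hK hsol hB hp hBp hμ
    (eventually_jacobianLe_add_const hdiag hoff hδ)

end Flow

section CoveringNumber

theorem coveringNumber_le_encard_image {X α : Type*} [PseudoEMetricSpace X] {K : Set X}
    {F : X → α} {r : ℝ≥0} (h : ∀ x ∈ K, ∀ y ∈ K, F x = F y → edist x y ≤ r) :
    Metric.coveringNumber r K ≤ (F '' K).encard := by
  obtain ⟨E, hEK, hE⟩ := (surjOn_image F K).exists_bijOn_subset
  rw [← hE.image_eq, hE.injOn.encard_image]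
  refine Metric.IsCover.coveringNumber_le_encard hEK fun x hx => ?_
  obtain ⟨y, hy, hyx⟩ := hE.surjOn (mem_image_of_mem F hx)
  exact ⟨y, hy, h x hx y (hEK hy) hyx.symm⟩

theorem floor_mem_Icc_of_abs_le {a : ℝ} {m : ℕ} (h : |a| ≤ m) :
    ⌊a⌋ ∈ Finset.Icc (-m : ℤ) m := by
  obtain ⟨hl, hu⟩ := abs_le.1 h
  refine Finset.mem_Icc.2 ⟨Int.le_floor.2 (by exact_mod_cast hl), ?_⟩
  exact_mod_cast (Int.floor_le a).trans hu

variable {ι : Type*} [Fintype ι] {K : Set (ι → ℝ)} {R : ℝ} {r : ℝ≥0}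

theorem coveringNumber_le_pow_of_subset_closedBall (hK : K ⊆ Metric.closedBall 0 R) (hr : 0 < r) :
    Metric.coveringNumber r K ≤ ((2 * ⌈R / r⌉₊ + 1) ^ Fintype.card ι : ℕ) := by
  classical
  set m : ℕ := ⌈R / r⌉₊
  have hr' : (0 : ℝ) < r := hr
  set cell : (ι → ℝ) → ι → ℤ := fun x i => ⌊x i / r⌋
  set box : Finset (ι → ℤ) := Fintype.piFinset fun _ => Finset.Icc (-m : ℤ) m
  have hcell : ∀ x ∈ K, ∀ y ∈ K, cell x = cell y → edist x y ≤ r := fun x _ y _ hxy => by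
    rw [edist_le_coe, ← NNReal.coe_le_coe, coe_nndist, dist_pi_le_iff hr'.le]
    intro i
    have hi := Int.abs_sub_lt_one_of_floor_eq_floor (congrFun hxy i)
    rw [← sub_div, abs_div, abs_of_pos hr', div_lt_one hr'] at hi
    exact hi.le
  have hbox : cell '' K ⊆ box := by
    rintro _ ⟨x, hx, rfl⟩
    refine Fintype.mem_piFinset.2 fun i => floor_mem_Icc_of_abs_le ?_
    calc |x i / r| = |x i| / r := by rw [abs_div, abs_of_pos hr']
      _ ≤ R / r := by
          gcongr
          exact (norm_le_pi_norm x i).trans (mem_closedBall_zero_iff.1 (hK hx))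
      _ ≤ m := Nat.le_ceil _
  calc Metric.coveringNumber r K ≤ (cell '' K).encard :=
        coveringNumber_le_encard_image hcell
    _ ≤ box.card := by
        rw [← encard_coe_eq_coe_finsetCard]
        exact encard_le_encard hbox
    _ = ((2 * m + 1) ^ Fintype.card ι : ℕ) := by
        simp only [box, Fintype.card_piFinset, Int.card_Icc, Finset.prod_const, Finset.card_univ]
        congr 2
        lia

theorem toENNReal_coveringNumber_le (hR : 0 ≤ R) (hK : K ⊆ Metric.closedBall 0 R) (hr : 0 < r) :
    (Metric.coveringNumber r K : ENNReal) ≤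
      ENNReal.ofReal ((2 * (R / r) + 3) ^ Fintype.card ι) := by
  have hceil : (⌈R / r⌉₊ : ℝ) ≤ R / r + 1 := (Nat.ceil_lt_add_one (by positivity)).le
  calc (Metric.coveringNumber r K : ENNReal)
      ≤ (((2 * ⌈R / r⌉₊ + 1) ^ Fintype.card ι : ℕ) : ℕ∞) :=
        ENat.toENNReal_le.2 (coveringNumber_le_pow_of_subset_closedBall hK hr)
    _ = ENNReal.ofReal ((2 * ⌈R / r⌉₊ + 1 : ℝ) ^ Fintype.card ι) := by
        rw [ENat.toENNReal_coe, ← ENNReal.ofReal_natCast]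
        push_cast
        rfl
    _ ≤ ENNReal.ofReal ((2 * (R / r) + 3) ^ Fintype.card ι) := by
        refine ENNReal.ofReal_le_ofReal (pow_le_pow_left₀ (by positivity) ?_ _)
        linarith

end CoveringNumber

section Entropy

variable {n : ℕ} {N : Seminorm ℝ (Fin n → ℝ)} {f : ℝ → (Fin n → ℝ) → (Fin n → ℝ)} {t₀ ε : ℝ}
  {K : Set (Fin n → ℝ)}

theorem minSpan_le_coveringNumber {T L : ℝ} (hL : 0 ≤ L)
    (h : ∀ x ∈ K, ∀ y ∈ K, ∀ t ∈ Icc t₀ (t₀ + T),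
      N (flow f t₀ t y - flow f t₀ t x) ≤ L * ‖y - x‖)
    {r : ℝ≥0} (hr : L * r < ε) : minSpan N f t₀ ε T K ≤ Metric.coveringNumber r K := by
  refine le_iInf₂ fun E hEK => le_iInf fun hE => iInf₂_le E ⟨hEK, fun y hy => ?_⟩
  obtain ⟨x, hxE, hyx⟩ := mem_iUnion₂.1 (hE.subset_iUnion_closedBall hy)
  refine mem_iUnion₂.2 ⟨x, hxE, fun t ht => ?_⟩
  calc N (flow f t₀ t y - flow f t₀ t x) ≤ L * ‖y - x‖ := h x (hEK hxE) y hy t ht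
    _ ≤ L * r := by gcongr; exact mem_closedBall_iff_norm.1 hyx
    _ < ε := hr

theorem exists_minSpan_le_mul_exp (hK : Bornology.IsBounded K) {M μ : ℝ} (hM : 0 < M) (hμ : 0 ≤ μ)
    (h : ∀ x ∈ K, ∀ y ∈ K, ∀ t, t₀ ≤ t →
      N (flow f t₀ t y - flow f t₀ t x) ≤ M * Real.exp (μ * (t - t₀)) * ‖y - x‖)
    (hε : 0 < ε) :
    ∃ D > 0, ∀ T, 0 ≤ T →
      (minSpan N f t₀ ε T K : ENNReal) ≤ ENNReal.ofReal (D * Real.exp (n * μ * T)) := by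
  obtain ⟨R, hR0, hKR⟩ := hK.subset_closedBall_lt 0 0
  refine ⟨(4 * R * M / ε + 3) ^ n, by positivity, fun T hT => ?_⟩
  obtain ⟨r, hr⟩ : ∃ r : ℝ≥0, (r : ℝ) = ε / (2 * M * Real.exp (μ * T)) :=
    ⟨NNReal.mk _ (by positivity), rfl⟩
  have hr0 : (0 : ℝ) < r := by rw [hr]; positivity
  have hrε : M * Real.exp (μ * T) * r < ε := by
    calc M * Real.exp (μ * T) * r = ε / 2 := by rw [hr]; field_simp
      _ < ε := half_lt_self hε
  have hexp : 1 ≤ Real.exp (μ * T) := Real.one_le_exp (by positivity)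
  have hlip : ∀ x ∈ K, ∀ y ∈ K, ∀ t ∈ Icc t₀ (t₀ + T),
      N (flow f t₀ t y - flow f t₀ t x) ≤ M * Real.exp (μ * T) * ‖y - x‖ :=
    fun x hx y hy t ht => (h x hx y hy t ht.1).trans (by gcongr; linarith [ht.2])
  calc (minSpan N f t₀ ε T K : ENNReal) ≤ Metric.coveringNumber r K :=
        ENat.toENNReal_le.2 (minSpan_le_coveringNumber (by positivity) hlip hrε)
    _ ≤ ENNReal.ofReal ((2 * (R / r) + 3) ^ n) := by
        simpa only [Fintype.card_fin] using toENNReal_coveringNumber_le hR0.le hKR hr0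
    _ = ENNReal.ofReal ((4 * R * M / ε * Real.exp (μ * T) + 3) ^ n) := by
        rw [hr]
        congr 3
        field_simp
        ring
    _ ≤ ENNReal.ofReal (((4 * R * M / ε + 3) * Real.exp (μ * T)) ^ n) := by
        gcongr
        linarith
    _ = ENNReal.ofReal ((4 * R * M / ε + 3) ^ n * Real.exp (n * μ * T)) := by
        rw [mul_pow, ← Real.exp_nat_mul, mul_assoc (n : ℝ)]

theorem entropyAt_le_of_minSpan_le {D c : ℝ} (hD : 0 < D)
    (h : ∀ᶠ T in atTop, (minSpan N f t₀ ε T K : ENNReal) ≤ ENNReal.ofReal (D * Real.exp (c * T))) :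
    entropyAt N f t₀ K ε ≤ c := by
  have hlim : Tendsto (fun T : ℝ => ((Real.log D / T + c : ℝ) : EReal)) atTop (𝓝 (c : EReal)) := by
    refine (continuous_coe_real_ereal.tendsto c).comp ?_
    simpa using (tendsto_id.const_div_atTop (Real.log D)).add_const c
  rw [← hlim.limsup_eq]
  refine limsup_le_limsup ?_
  filter_upwards [h, eventually_gt_atTop (0 : ℝ)] with T hspan hT
  calc ENNReal.log (minSpan N f t₀ ε T K : ENNReal) / (T : EReal)
      ≤ ENNReal.log (ENNReal.ofReal (D * Real.exp (c * T))) / (T : EReal) :=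
        EReal.div_le_div_right_of_nonneg (by exact_mod_cast hT.le) (ENNReal.log_monotone hspan)
    _ = ((Real.log (D * Real.exp (c * T)) / T : ℝ) : EReal) := by
        rw [ENNReal.log_ofReal_of_pos (by positivity), EReal.coe_div]
    _ = ((Real.log D / T + c : ℝ) : EReal) := by
        rw [Real.log_mul hD.ne' (Real.exp_ne_zero _), Real.log_exp, add_div,
          mul_div_cancel_right₀ _ hT.ne']

theorem exists_seminorm_le_mul_norm {E : Type*} [NormedAddCommGroup E] [NormedSpace ℝ E]
    [FiniteDimensional ℝ E] (N : Seminorm ℝ E) : ∃ c > 0, ∀ x, N x ≤ c * ‖x‖ :=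
  N.bound_of_continuous_normedSpace (continuousOn_univ.1 (N.convexOn.continuousOn isOpen_univ))

theorem entropy_le_of_norm_flow_sub_le (hK : Bornology.IsBounded K) {M μ : ℝ} (hM : 0 < M)
    (hμ : 0 ≤ μ) (h : ∀ x ∈ K, ∀ y ∈ K, ∀ t, t₀ ≤ t →
      ‖flow f t₀ t y - flow f t₀ t x‖ ≤ M * Real.exp (μ * (t - t₀)) * ‖y - x‖) :
    entropy N f t₀ K ≤ ((n * μ : ℝ) : EReal) := by
  obtain ⟨c, hc0, hc⟩ := exists_seminorm_le_mul_norm N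
  have hN : ∀ x ∈ K, ∀ y ∈ K, ∀ t, t₀ ≤ t →
      N (flow f t₀ t y - flow f t₀ t x) ≤ c * M * Real.exp (μ * (t - t₀)) * ‖y - x‖ :=
    fun x hx y hy t ht =>
      calc N (flow f t₀ t y - flow f t₀ t x) ≤ c * ‖flow f t₀ t y - flow f t₀ t x‖ := hc _
        _ ≤ c * (M * Real.exp (μ * (t - t₀)) * ‖y - x‖) := by gcongr; exact h x hx y hy t ht
        _ = c * M * Real.exp (μ * (t - t₀)) * ‖y - x‖ := by ring
  refine iSup₂_le fun ε hε => ?_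
  obtain ⟨D, hD0, hD⟩ := exists_minSpan_le_mul_exp hK (mul_pos hc0 hM) hμ hN hε
  exact entropyAt_le_of_minSpan_le hD0 ((eventually_ge_atTop 0).mono hD)

end Entropy

end TVSys

theorem proposition1_general {n : ℕ} (N : Seminorm ℝ (Fin n → ℝ))
    {f : ℝ → (Fin n → ℝ) → (Fin n → ℝ)} {t₀ : ℝ}
    (hfd : ∀ t, t₀ ≤ t → Differentiable ℝ (f t)) (hJ : TVSys.HasLocallyBoundedJacobian f t₀)
    {K : Set (Fin n → ℝ)} (hK : Bornology.IsBounded K)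
    (hsol : ∀ x ∈ closure K, ∃ φ, TVSys.IsSolution f t₀ x φ)
    {A : Matrix (Fin n) (Fin n) ℝ} (hA : TVSys.IsMetzler A)
    (hdiag : ∀ i, limsup (fun t : ℝ => ⨆ v ∈ convexHull ℝ (TVSys.reach f t₀ t K),
      ((TVSys.partialDeriv f i i t v : ℝ) : EReal)) atTop ≤ ((A i i : ℝ) : EReal))
    (hoff : ∀ i j, i ≠ j → limsup (fun t : ℝ => ⨆ v ∈ convexHull ℝ (TVSys.reach f t₀ t K),
      ((|TVSys.partialDeriv f i j t v| : ℝ) : EReal)) atTop ≤ ((A i j : ℝ) : EReal)) :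
    TVSys.entropy N f t₀ K ≤ (((n : ℝ) * max (TVSys.spectralAbscissa A) 0 : ℝ) : EReal) := by
  have hbound : ∀ μ, max (TVSys.spectralAbscissa A) 0 < μ →
      TVSys.entropy N f t₀ K ≤ ((n * μ : ℝ) : EReal) := fun μ hμ => by
    obtain ⟨hAμ, hμ0⟩ := max_lt_iff.1 hμ
    obtain ⟨M, hM0, hM⟩ :=
      TVSys.exists_norm_flow_sub_le_exp hfd hJ hK hsol hA hdiag hoff hμ0.le hAμ
    exact TVSys.entropy_le_of_norm_flow_sub_le hK hM0 hμ0.le hM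
  have hcont : Continuous fun μ : ℝ => ((n * μ : ℝ) : EReal) :=
    continuous_coe_real_ereal.comp (continuous_const.mul continuous_id)
  exact ge_of_tendsto (hcont.continuousWithinAt (s := Ioi _)).tendsto
    (eventually_mem_nhdsWithin.mono hbound)

theorem proposition1 {n : ℕ}
    (N : Seminorm ℝ (Fin n → ℝ)) (hN : ∀ x, N x = 0 → x = 0)
    (f : ℝ → (Fin n → ℝ) → (Fin n → ℝ)) (t₀ : ℝ)
    (hf : TVSys.Regular f t₀) (hfc : TVSys.ForwardComplete f t₀)
    (K : Set (Fin n → ℝ)) (hK : IsCompact K) (hKi : (interior K).Nonempty)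
    (A : Matrix (Fin n) (Fin n) ℝ) (hA : TVSys.IsMetzler A)
    (hdiag : ∀ i, limsup (fun t : ℝ => ⨆ v ∈ convexHull ℝ (TVSys.reach f t₀ t K),
      ((TVSys.partialDeriv f i i t v : ℝ) : EReal)) atTop ≤ ((A i i : ℝ) : EReal))
    (hoff : ∀ i j, i ≠ j → limsup (fun t : ℝ => ⨆ v ∈ convexHull ℝ (TVSys.reach f t₀ t K),
      ((|TVSys.partialDeriv f i j t v| : ℝ) : EReal)) atTop ≤ ((A i j : ℝ) : EReal)) :
    TVSys.entropy N f t₀ K ≤ (((n : ℝ) * max (TVSys.spectralAbscissa A) 0 : ℝ) : EReal) := by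
  exact proposition1_general N (fun t ht => (hf.contDiff t ht).differentiable one_ne_zero)
    hf.jacobian_locally_bounded hK.isBounded (fun x _ => hfc x) hA hdiag hoff
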